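/- Let $P$ be a simple polygon with edge set $E$ and let $\delta\colon E\to\mathbb{R}_{\ge 0}$ assign an additive weight to each edge. In the additively-weighted wavefront propagation of $(P,\delta)$ the wavefront at time $0$ is $P$ itself; at time $t$ the wavefront fragments emanated by an edge $e$ lie on the line $\overline{e}+\max(0,t-\delta(e))\,n_e$, where $\overline{e}$ is the supporting line of $e$ and $n_e$ its inward unit normal (so the edge starts to move inwards, self-parallel and at unit speed, at time $\delta(e)$); incidences between wavefront edges are preserved, except that planarity is restored at events: an edge that has shrunk to length zero is removed and its neighbours become adjacent, a wavefront polygon is split where one of its vertices reaches another part of it, and the common portion of parallel edges that have moved into each other is removed. The process ends when all wavefront polygons have collapsed. Let $e(t)$ be the union of the wavefront fragments of $e$ at time $t$. The face of $e$ in the additively-weighted straight skeleton $S(P,\delta)$ is $f(e)=\bigcup_{t\ge 0}e(t)$. It is called monotone with respect to $e$ if every line perpendicular to $\overline{e}$ meets $f(e)$ in a connected (possibly empty) set. A face of an additively-weighted straight skeleton need not be monotone with respect to the edge that emanated it: there exist a simple polygon $P$, additive weights $\delta\colon E\to\mathbb{R}_{\ge 0}$ for which the wavefront propagation exists, and an edge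 $e$ of $P$ such that the face $f(e)$ of $S(P,\delta)$ is not monotone with respect to $e$. -/

import Mathlib

noncomputable section

namespace StraightSkeleton

/-- The Euclidean plane. -/
abbrev Plane : Type := EuclideanSpace ℝ (Fin 2)

/-- A closed polygonal chain whose edges stem from the edges of an `n`-gon, written as the cyclic
list of its vertices. The entry `(e, p)` is a vertex `p` together with the polygon edge `e` that
emanated the chain edge leaving `p`; that chain edge ends at the next vertex of the cyclic list. -/
abbrev Chain (n : ℕ) : Type := List (Fin n × Plane)

variable {n : ℕ}

/-- The edges of a closed chain, as triples (emanating polygon edge, start point, end point). -/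
def chainEdges (c : Chain n) : List (Fin n × Plane × Plane) :=
  List.zipWith (fun v w => (v.1, v.2, w.2)) c (c.rotate 1)

/-- The half-open segment from `p` (included) to `q` (excluded); it is `{p}` if `p = q`. -/
def halfOpenSegment (p q : Plane) : Set Plane :=
  AffineMap.lineMap (k := ℝ) p q '' Set.Ico 0 1

/-- A closed chain is simple if it has at least three edges and runs through no point twice:
its edges, each taken with its start point and without its end point, are pairwise disjoint. -/
def IsSimpleChain (c : Chain n) : Prop :=
  3 ≤ c.length ∧
    (chainEdges c).Pairwise fun g h =>
      Disjoint (halfOpenSegment g.2.1 g.2.2) (halfOpenSegment h.2.1 h.2.2)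

/-- The boundary of a polygon as a closed chain; the edge `i` leads from vertex `i` to the
cyclically next vertex. -/
def inputChain (P : Polygon Plane n) : Chain n :=
  List.ofFn fun i => (i, P i)

/-- `P` is a simple polygon. -/
def IsSimplePolygon (P : Polygon Plane n) : Prop :=
  IsSimpleChain (inputChain P)

/-- The vector from the start to the end of edge `e`. -/
def edgeVector (P : Polygon Plane n) (e : Fin n) : Plane :=
  P (finRotate n e) - P e

/-- Twice the signed area of a polygon (shoelace formula). It is positive for a simple polygon that
is traversed counterclockwise, and negative for one that is traversed clockwise. -/
def signedArea (P : Polygon Plane n) : ℝ :=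
  ∑ i, (P i 0 * P (finRotate n i) 1 - P i 1 * P (finRotate n i) 0)

/-- The unit normal of edge `e` that points into the interior of the simple polygon: the left unit
normal of the edge if the polygon is traversed counterclockwise, the right one otherwise. -/
def inwardNormal (P : Polygon Plane n) (e : Fin n) : Plane :=
  (Real.sign (signedArea P) * ‖edgeVector P e‖⁻¹) • !₂[-(edgeVector P e 1), edgeVector P e 0]

/-- The supporting line at time `t` of the wavefront edges emanated by `e`: the supporting line of
`e` translated by `max 0 (t - δ e)` in the direction of the inward unit normal. -/
def supportLine (P : Polygon Plane n) (δ : Fin n → ℝ) (e : Fin n) (t : ℝ) : Set Plane :=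
  {x | x - max 0 (t - δ e) • inwardNormal P e ∈ line[ℝ, P e, P (finRotate n e)]}

/-- A moving wavefront polygon: a chain whose vertices are functions of time. -/
abbrev MovingChain (n : ℕ) : Type := List (Fin n × (ℝ → Plane))

/-- The position of a moving chain at time `t`. -/
def chainAt (t : ℝ) (m : MovingChain n) : Chain n :=
  m.map fun v => (v.1, v.2 t)

/-- The chain `m` moves as a wavefront polygon during the time interval `[a, b]`, without events in
the open interval `(a, b)`. At each time every edge lies on its supporting line, incidences are
preserved, every vertex moves with constant velocity, and the chain is simple strictly between
`a` and `b`. A vertex is the common point of two supporting lines, which determines its motion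
unless the two edges are parallel; in that case the vertex moves perpendicularly to them (the
velocity lies in the span of their normals). -/
def IsMoving (P : Polygon Plane n) (δ : Fin n → ℝ) (a b : ℝ) (m : MovingChain n) : Prop :=
  (∀ uv ∈ List.zip m (m.rotate 1),
    (∀ t ∈ Set.Icc a b,
      uv.2.2 t ∈ supportLine P δ uv.1.1 t ∧ uv.2.2 t ∈ supportLine P δ uv.2.1 t) ∧
    ∃ w ∈ Submodule.span ℝ {inwardNormal P uv.1.1, inwardNormal P uv.2.1},
      ∀ t ∈ Set.Icc a b, uv.2.2 t = uv.2.2 a + (t - a) • w) ∧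
  ∀ t ∈ Set.Ioo a b, IsSimpleChain (chainAt t m)

/-- `Resolves cs ds`: the list `ds` of simple chains arises from the list `cs` of closed chains by
restoring planarity.
A simple chain is kept. A chain with at most two edges has no interior and is removed. A chain that
visits a point twice, be it at two vertices or at a vertex and in the relative interior of an edge,
is cut there into two closed chains (with `~r` for equality up to the choice of the first vertex).

* Edge event: an edge of length zero is cut off at its two coinciding end points as a chain with one
  edge, which is then removed; its two neighbours become adjacent.
* Split event: a vertex that has reached another part of the chain cuts it into two chains; an edge
  that is hit in its interior contributes a fragment to each of them.
* Parallel edges that have moved into each other are cut at their end points; their common portion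
  forms a chain with two edges, which is removed, and the other portions remain.
* Combinations of these, as in the collapse of a whole chain, are several such steps. -/
inductive Resolves : List (Chain n) → List (Chain n) → Prop
  | nil : Resolves [] []
  | keep {c : Chain n} {cs ds : List (Chain n)} :
      IsSimpleChain c → Resolves cs ds → Resolves (c :: cs) (c :: ds)
  | remove {c : Chain n} {cs ds : List (Chain n)} :
      c.length ≤ 2 → Resolves cs ds → Resolves (c :: cs) ds
  | cutAtVertex {c X Y : Chain n} {cs ds : List (Chain n)} {a b : Fin n} {p : Plane} :
      c ~r ((a, p) :: X ++ (b, p) :: Y) →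
      Resolves (((a, p) :: X) :: ((b, p) :: Y) :: cs) ds → Resolves (c :: cs) ds
  | cutAtEdge {c X Y : Chain n} {cs ds : List (Chain n)} {a b d : Fin n} {p q r : Plane} :
      c ~r ((a, p) :: X ++ (b, q) :: (d, r) :: Y) → p ∈ openSegment ℝ q r →
      Resolves (((a, p) :: X ++ [(b, q)]) :: ((b, p) :: (d, r) :: Y) :: cs) ds →
      Resolves (c :: cs) ds

/-- The additively-weighted wavefront propagation of `P`
with additive weights `δ`: finitely many phases `[time k, time (k + 1)]`, starting at time zero with
the polygon itself. During a phase the wavefront polygons `phase k` move without events, at the end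
of a phase planarity is restored, and the process ends when all wavefront polygons have collapsed.
Speed-change events also separate phases, since vertices have constant velocity in a phase. -/
structure Propagation (P : Polygon Plane n) (δ : Fin n → ℝ) where
  /-- the number of phases -/
  steps : ℕ
  /-- the start times of the phases; `time steps` is the end of the process -/
  time : ℕ → ℝ
  /-- the wavefront polygons in each phase -/
  phase : ℕ → List (MovingChain n)
  time_zero : time 0 = 0
  time_lt : ∀ k < steps, time k < time (k + 1)
  start : (phase 0).map (chainAt 0) = [inputChain P]
  moving : ∀ k < steps, ∀ m ∈ phase k, IsMoving P δ (time k) (time (k + 1)) m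
  resolves : ∀ k < steps,
    Resolves ((phase k).map (chainAt (time (k + 1)))) ((phase (k + 1)).map (chainAt (time (k + 1))))
  collapsed : phase steps = []

/-- The union `e(t)` of the wavefront fragments at time `t` that are emanated by the edge `e`. (At
the time of an event this includes the fragments as they arrive at the event.) -/
def Propagation.fragments {P : Polygon Plane n} {δ : Fin n → ℝ} (W : Propagation P δ)
    (e : Fin n) (t : ℝ) : Set Plane :=
  {x | ∃ k < W.steps, t ∈ Set.Icc (W.time k) (W.time (k + 1)) ∧
    ∃ m ∈ W.phase k, ∃ g ∈ chainEdges (chainAt t m), g.1 = e ∧ x ∈ segment ℝ g.2.1 g.2.2}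

/-- The face `f(e)` of the edge `e`: the region traced out by the fragments of `e` over time. -/
def Propagation.face {P : Polygon Plane n} {δ : Fin n → ℝ} (W : Propagation P δ)
    (e : Fin n) : Set Plane :=
  ⋃ t ≥ (0 : ℝ), W.fragments e t

/-- A planar set is monotone with respect to a line of direction `d` if each line perpendicular to
it meets the set in a connected (possibly empty) set. -/
def IsMonotoneWrt (S : Set Plane) (d : Plane) : Prop :=
  ∀ x : Plane, IsPreconnected (S ∩ {y | inner ℝ (y - x) d = 0})

end StraightSkeleton

end

namespace StraightSkeleton

open Set

/-! The witness is a quadrilateral with a reflex vertex at the origin, between edge 3 (on 4y = 3x)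
and edge 0 (on y = 0). Edge 0 starts at once, edge 3 only at time 1. Until then the reflex vertex
slides along the resting edge 3 to (4/3, 1); afterwards it moves back to the left, with x = (5 -
t)/3. The left boundary of the face of edge 0 thus has a bulge to the right, and the line x = 1
meets the face at heights 0 and 2 but not at height 1. Edges 1 and 2 rest until time 5, when all
four supporting lines meet in (0, 5) and the whole wavefront collapses, so no other event has to be
resolved.

The claim concerns every propagation, so uniqueness before time 5 is needed. Adjacent supporting
lines are never parallel and so determine the vertices (`IsMoving.chainAt_eq_dartWavefront`); the
resulting chain is simple, and a simple chain cannot be cut or removed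
(`Resolves.eq_of_isSimpleChain`). Induction over the phases then fixes the wavefront, however time
is subdivided. -/

/-! ### Simple chains and general propagations -/

theorem chainEdges_rotate {n : ℕ} (c : Chain n) (k : ℕ) :
    chainEdges (c.rotate k) = (chainEdges c).rotate k := by
  unfold chainEdges
  rw [List.zipWith_rotate_distrib _ _ _ _ (by simp), List.rotate_rotate, List.rotate_rotate,
    add_comm]

/-- Simplicity of a chain does not depend on the choice of the first vertex. -/
theorem IsSimpleChain.of_isRotated {n : ℕ} {c d : Chain n} (hc : IsSimpleChain c) (h : c ~r d) :
    IsSimpleChain d := by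
  obtain ⟨k, rfl⟩ := h
  refine ⟨by simpa using hc.1, ?_⟩
  rw [chainEdges_rotate]
  exact ((List.rotate_perm _ k).pairwise_iff (fun h => h.symm)).2 hc.2

theorem left_mem_halfOpenSegment (p q : Plane) : p ∈ halfOpenSegment p q :=
  ⟨0, by simp, by simp⟩

theorem openSegment_subset_halfOpenSegment (p q : Plane) :
    openSegment ℝ p q ⊆ halfOpenSegment p q := by
  rw [openSegment_eq_image_lineMap]
  exact image_mono Ioo_subset_Ico_self

theorem IsSimpleChain.disjoint_getElem {n : ℕ} {l : Chain n} (hl : IsSimpleChain l)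
    {i j i' j' : ℕ} (hij : i < j) (hj : j < l.length) (hi' : i' < l.length) (hj' : j' < l.length)
    (hi'' : (i + 1) % l.length = i') (hj'' : (j + 1) % l.length = j') :
    Disjoint (halfOpenSegment l[i].2 l[i'].2) (halfOpenSegment l[j].2 l[j'].2) := by
  subst hi'' hj''
  have h := List.pairwise_iff_getElem.1 hl.2 i j (by simp [chainEdges]; lia)
    (by simp [chainEdges]; lia) hij
  simpa [chainEdges, List.getElem_rotate] using h

/-- A simple chain is unaffected by restoring planarity. -/
theorem Resolves.eq_of_isSimpleChain {n : ℕ} {c : Chain n} {ds : List (Chain n)}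
    (h : Resolves [c] ds) (hc : IsSimpleChain c) : ds = [c] := by
  cases h with
  | keep _ h => cases h; rfl
  | remove h _ => have := hc.1; lia
  | @cutAtVertex _ X Y _ _ a b p h _ =>
    -- Either kind of cut needs a point `p` lying on two different half-open edges, which simplicity
    -- forbids.
    have hd := (hc.of_isRotated h).disjoint_getElem (i := 0) (j := X.length + 1) (by lia) (by simp)
      (Nat.mod_lt _ (by simp)) (Nat.mod_lt _ (by simp)) rfl rfl
    refine absurd ?_ (Set.disjoint_left.1 hd (left_mem_halfOpenSegment p _))
    convert left_mem_halfOpenSegment p _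
    simp
  | @cutAtEdge _ X Y _ _ a b d p q r h hp _ =>
    have hd := (hc.of_isRotated h).disjoint_getElem (i := 0) (j := X.length + 1)
      (j' := X.length + 2) (by lia) (by simp) (Nat.mod_lt _ (by simp)) (by simp) rfl
      (Nat.mod_eq_of_lt (by simp))
    refine absurd ?_ (Set.disjoint_left.1 hd (left_mem_halfOpenSegment p _))
    convert openSegment_subset_halfOpenSegment q r hp
    · simp
    · simp [List.getElem_append_right]

/-- The edges of a moving chain stay on their supporting lines. -/
theorem IsMoving.mem_supportLine {n : ℕ} {P : Polygon Plane n} {δ : Fin n → ℝ} {a b t : ℝ}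
    {m : MovingChain n} (hm : IsMoving P δ a b m) (ht : t ∈ Icc a b) {g : Fin n × Plane × Plane}
    (hg : g ∈ chainEdges (chainAt t m)) :
    g.2.1 ∈ supportLine P δ g.1 t ∧ g.2.2 ∈ supportLine P δ g.1 t := by
  obtain ⟨i, hi, rfl⟩ := List.mem_iff_getElem.1 hg
  have hi' : i < m.length := by simpa [chainEdges, chainAt] using hi
  have key (j : ℕ) (hj : j < m.length) :
      (m[(j + 1) % m.length]'(Nat.mod_lt _ (by lia))).2 t ∈ supportLine P δ m[j].1 t ∧
      (m[(j + 1) % m.length]'(Nat.mod_lt _ (by lia))).2 t ∈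
        supportLine P δ (m[(j + 1) % m.length]'(Nat.mod_lt _ (by lia))).1 t := by
    have := (hm.1 _ (List.getElem_mem (l := List.zip m (m.rotate 1)) (n := j)
      (by simpa using hj))).1 t ht
    simpa [List.getElem_rotate] using this
  constructor
  · have h := (key ((i + (m.length - 1)) % m.length) (Nat.mod_lt _ (by lia))).2
    have e : ((i + (m.length - 1)) % m.length + 1) % m.length = i := by
      rw [Nat.mod_add_mod, show i + (m.length - 1) + 1 = i + m.length by lia,
        Nat.add_mod_right, Nat.mod_eq_of_lt hi']
    simp only [e] at h
    simpa [chainEdges, chainAt] using h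
  · simpa [chainEdges, chainAt, List.getElem_rotate] using (key i hi').1

theorem Propagation.time_nonneg {n : ℕ} {P : Polygon Plane n} {δ : Fin n → ℝ}
    (W : Propagation P δ) {k : ℕ} (hk : k ≤ W.steps) : 0 ≤ W.time k := by
  induction k with
  | zero => exact W.time_zero.ge
  | succ k ih => exact (ih (by lia)).trans (W.time_lt k (by lia)).le

/-! ### The witness polygon, its normals and supporting lines -/

/-- A nonconvex quadrilateral with reflex vertex at the origin. -/
def dart : Polygon Plane 4 := ⟨![!₂[0, 0], !₂[5, 0], !₂[0, 5], !₂[-4, -3]]⟩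

/-- The additive weights of the edges of `dart`. -/
noncomputable def dartDelay : Fin 4 → ℝ := ![0, 5, 5, 1]

/-- The wavefront of `dart` up to its collapse at time `5`. -/
noncomputable def dartWavefront : MovingChain 4 :=
  [(0, fun t => !₂[(4 * t - 5 * max 0 (t - 1)) / 3, t]), (1, fun t => !₂[5 - t, t]),
    (2, fun _ => !₂[0, 5]), (3, fun t => !₂[max 0 (t - 1) - 4, 2 * max 0 (t - 1) - 3])]

@[simp] theorem dart_zero : dart 0 = !₂[0, 0] := rfl
@[simp] theorem dart_one : dart 1 = !₂[5, 0] := rfl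
@[simp] theorem dart_two : dart 2 = !₂[0, 5] := rfl
@[simp] theorem dart_three : dart 3 = !₂[-4, -3] := rfl
@[simp] theorem finRotate_four_zero : finRotate 4 0 = 1 := rfl
@[simp] theorem finRotate_four_one : finRotate 4 1 = 2 := rfl
@[simp] theorem finRotate_four_two : finRotate 4 2 = 3 := rfl
@[simp] theorem finRotate_four_three : finRotate 4 3 = 0 := rfl

theorem plane_ext {p q : Plane} (h0 : p 0 = q 0) (h1 : p 1 = q 1) : p = q := by
  ext i; fin_cases i <;> assumption

theorem sign_signedArea_dart : Real.sign (signedArea dart) = 1 := by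
  apply Real.sign_of_pos
  simp [signedArea, Fin.sum_univ_four]
  norm_num

theorem inwardNormal_dart_zero : inwardNormal dart 0 = !₂[0, 1] := by
  have : ‖edgeVector dart 0‖ = 5 := by
    simp [edgeVector, EuclideanSpace.norm_eq, Fin.sum_univ_two]
  apply plane_ext <;> simp [inwardNormal, sign_signedArea_dart, this] <;> simp [edgeVector]

theorem inwardNormal_dart_three : inwardNormal dart 3 = !₂[-3 / 5, 4 / 5] := by
  have : ‖edgeVector dart 3‖ = 5 := by
    simp [edgeVector, EuclideanSpace.norm_eq, Fin.sum_univ_two]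
    rw [show (4 : ℝ) ^ 2 + 3 ^ 2 = 5 ^ 2 by norm_num, Real.sqrt_sq (by norm_num)]
  apply plane_ext <;> simp [inwardNormal, sign_signedArea_dart, this] <;> simp [edgeVector] <;> ring

/-- Edges 1 and 2 rest until time 5, so their normals matter only through their spans; the
irrational scale factor stays unspecified. -/
theorem exists_inwardNormal_dart_one : ∃ r : ℝ, r ≠ 0 ∧ inwardNormal dart 1 = !₂[-r, -r] := by
  have h : edgeVector dart 1 = !₂[-5, 5] := by apply plane_ext <;> simp [edgeVector]
  refine ⟨‖edgeVector dart 1‖⁻¹ * 5, ?_, ?_⟩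
  · simp only [ne_eq, mul_eq_zero, inv_eq_zero, norm_eq_zero, not_or]
    refine ⟨fun h0 => ?_, by norm_num⟩
    have := congrArg (fun v : Plane => v 1) (h.symm.trans h0)
    simp at this
  · apply plane_ext <;> simp [inwardNormal, sign_signedArea_dart] <;> simp [h]

theorem exists_inwardNormal_dart_two :
    ∃ r : ℝ, r ≠ 0 ∧ inwardNormal dart 2 = !₂[2 * r, -r] := by
  have h : edgeVector dart 2 = !₂[-4, -8] := by
    apply plane_ext <;> simp [edgeVector]
    norm_num
  refine ⟨‖edgeVector dart 2‖⁻¹ * 4, ?_, ?_⟩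
  · simp only [ne_eq, mul_eq_zero, inv_eq_zero, norm_eq_zero, not_or]
    refine ⟨fun h0 => ?_, by norm_num⟩
    have := congrArg (fun v : Plane => v 1) (h.symm.trans h0)
    simp at this
  · apply plane_ext <;> simp [inwardNormal, sign_signedArea_dart] <;> simp [h]
    ring

/-- The line through two distinct points, by its equation. -/
theorem mem_line_iff {p q x : Plane} (hpq : p ≠ q) :
    x ∈ line[ℝ, p, q] ↔ (x 0 - p 0) * (q 1 - p 1) = (x 1 - p 1) * (q 0 - p 0) := by
  rw [mem_affineSpan_pair_iff_exists_lineMap_eq]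
  constructor
  · rintro ⟨r, rfl⟩
    simp [AffineMap.lineMap_apply]
    ring
  · intro h
    by_cases h0 : q 0 - p 0 = 0
    · have h1 : q 1 - p 1 ≠ 0 := fun h1 => hpq (plane_ext (by linarith) (by linarith))
      refine ⟨(x 1 - p 1) / (q 1 - p 1), plane_ext ?_ ?_⟩
      · have : x 0 - p 0 = 0 := by
          rw [h0, mul_zero] at h
          exact (mul_eq_zero.1 h).resolve_right h1
        simp [AffineMap.lineMap_apply, h0]
        linarith
      · simp [AffineMap.lineMap_apply]
        field_simp
        ring
    · refine ⟨(x 0 - p 0) / (q 0 - p 0), plane_ext ?_ ?_⟩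
      · simp [AffineMap.lineMap_apply]
        field_simp
        ring
      · simp [AffineMap.lineMap_apply]
        field_simp
        linarith

theorem ne_of_apply_ne {p q : Plane} (i : Fin 2) (h : p i ≠ q i) : p ≠ q :=
  fun e => h (e ▸ rfl)

theorem mem_supportLine_dart_zero {t : ℝ} (ht : 0 ≤ t) {x : Plane} :
    x ∈ supportLine dart dartDelay 0 t ↔ x 1 = t := by
  rw [supportLine, mem_ofPred_eq, mem_line_iff (ne_of_apply_ne 0 (by simp)),
    inwardNormal_dart_zero]
  simp [dartDelay, max_eq_right ht, sub_eq_zero]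

theorem mem_supportLine_dart_one {t : ℝ} (ht : t ≤ 5) {x : Plane} :
    x ∈ supportLine dart dartDelay 1 t ↔ x 0 + x 1 = 5 := by
  rw [supportLine, mem_ofPred_eq, mem_line_iff (ne_of_apply_ne 0 (by simp))]
  simp [dartDelay, max_eq_left (sub_nonpos.2 ht)]
  constructor <;> intro h <;> linarith

theorem mem_supportLine_dart_two {t : ℝ} (ht : t ≤ 5) {x : Plane} :
    x ∈ supportLine dart dartDelay 2 t ↔ x 1 = 2 * x 0 + 5 := by
  rw [supportLine, mem_ofPred_eq, mem_line_iff (ne_of_apply_ne 0 (by simp))]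
  simp [dartDelay, max_eq_left (sub_nonpos.2 ht)]
  constructor <;> intro h <;> linarith

theorem mem_supportLine_dart_three {t : ℝ} {x : Plane} :
    x ∈ supportLine dart dartDelay 3 t ↔ -3 * x 0 + 4 * x 1 = 5 * max 0 (t - 1) := by
  rw [supportLine, mem_ofPred_eq, mem_line_iff (ne_of_apply_ne 0 (by simp)),
    inwardNormal_dart_three]
  simp [dartDelay]
  constructor <;> intro h <;> linarith

/-! ### Simplicity and motion of the wavefront -/

theorem isSimpleChain_quadrilateral {a c t : ℝ} (ha : 0 ≤ a) (hat : a + t < 5) (hc : c < 0) :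
    IsSimpleChain ([(0, !₂[a, t]), (1, !₂[5 - t, t]), (2, !₂[0, 5]), (3, !₂[c, 2 * c + 5])] :
      Chain 4) := by
  refine ⟨by simp, ?_⟩
  have key (p q r s : Plane) (h : ∀ u ∈ Ico (0 : ℝ) 1, ∀ v ∈ Ico (0 : ℝ) 1,
      p 0 + u * (q 0 - p 0) = r 0 + v * (s 0 - r 0) →
      p 1 + u * (q 1 - p 1) = r 1 + v * (s 1 - r 1) → False) :
      Disjoint (halfOpenSegment p q) (halfOpenSegment r s) := by
    rw [disjoint_left]
    rintro _ ⟨u, hu, rfl⟩ ⟨v, hv, e⟩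
    have e0 := congrArg (fun x : Plane => x 0) e
    have e1 := congrArg (fun x : Plane => x 1) e
    simp [AffineMap.lineMap_apply] at e0 e1
    exact h u hu v hv (by linarith) (by linarith)
  simp only [chainEdges, List.rotate_cons_succ, List.rotate_zero, List.cons_append,
    List.nil_append, List.zipWith_cons_cons, List.zipWith_nil_left, List.pairwise_cons,
    List.mem_cons, List.not_mem_nil, or_false, forall_eq_or_imp, forall_eq, List.Pairwise.nil,
    and_true, false_imp_iff, implies_true]
  -- Each pair is separated by a linear function: y for edges 0, 1; x for 0, 2 and 0, 3 and 1, 2; x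
  -- + y for 1, 3; y - 2x for 2, 3. Where closed edges touch, the excluded end point or the other
  -- coordinate decides.
  refine ⟨⟨?_, ?_, ?_⟩, ⟨?_, ?_⟩, ?_⟩ <;> apply key <;> rintro u ⟨hu0, hu1⟩ v ⟨hv0, hv1⟩ e0 e1 <;>
    simp at e0 e1
  · rcases e1 with rfl | e1
    · nlinarith [mul_pos (sub_pos.2 hu1) (sub_pos.2 hat)]
    · linarith
  · have h1 : 0 ≤ u * (5 - t - a) := mul_nonneg hu0 (by linarith)
    have h2 : 0 ≤ v * -c := mul_nonneg hv0 (by linarith)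
    nlinarith
  · have h1 : 0 ≤ u * (5 - t - a) := mul_nonneg hu0 (by linarith)
    have h2 : 0 < (1 - v) * (a - c) := mul_pos (by linarith) (by linarith)
    nlinarith
  · have h1 : 0 < (1 - u) * (5 - t) := mul_pos (by linarith) (by linarith)
    have h2 : 0 ≤ v * -c := mul_nonneg hv0 (by linarith)
    nlinarith
  · have h1 : 0 ≤ v * (5 - t - a) := mul_nonneg hv0 (by linarith)
    have h2 : 0 < (1 - v) * -c := mul_pos (by linarith) (by linarith)
    nlinarith
  · have h1 : 0 < (1 - u) * -c := mul_pos (by linarith) (by linarith)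
    have h2 : v * (t - 5 - 2 * a) = 0 := by linarith
    have h3 : v = 0 := (mul_eq_zero.1 h2).resolve_right (by linarith)
    subst h3
    linarith

theorem isSimpleChain_dartWavefront {t : ℝ} (h0 : 0 ≤ t) (h5 : t < 5) :
    IsSimpleChain (chainAt t dartWavefront) := by
  have h := isSimpleChain_quadrilateral (a := (4 * t - 5 * max 0 (t - 1)) / 3)
    (c := max 0 (t - 1) - 4) (t := t)
    (by rcases max_cases 0 (t - 1) with h | h <;> linarith)
    (by rcases max_cases 0 (t - 1) with h | h <;> linarith)
    (by rcases max_cases 0 (t - 1) with h | h <;> linarith)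
  rw [show 2 * (max 0 (t - 1) - 4) + 5 = 2 * max 0 (t - 1) - 3 by ring] at h
  simpa [chainAt, dartWavefront] using h

theorem chainAt_zero_dartWavefront : chainAt 0 dartWavefront = inputChain dart := by
  simp [chainAt, dartWavefront, inputChain, List.ofFn_succ]

theorem isSimplePolygon_dart : IsSimplePolygon dart := by
  rw [IsSimplePolygon, ← chainAt_zero_dartWavefront]
  exact isSimpleChain_dartWavefront le_rfl (by norm_num)

/-- The supporting lines of adjacent edges of `dart` determine its wavefront vertices. -/
theorem IsMoving.chainAt_eq_dartWavefront {a b t : ℝ} {m : MovingChain 4}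
    (hm : IsMoving dart dartDelay a b m) (hl : m.map Prod.fst = [0, 1, 2, 3])
    (ht : t ∈ Icc a b) (h0 : 0 ≤ t) (h5 : t ≤ 5) : chainAt t m = chainAt t dartWavefront := by
  match m, hl with
  | [(i0, u0), (i1, u1), (i2, u2), (i3, u3)], hl =>
    simp only [List.map_cons, List.map_nil, List.cons.injEq, and_true] at hl
    obtain ⟨rfl, rfl, rfl, rfl⟩ := hl
    have h := hm.1
    simp only [List.rotate_cons_succ, List.rotate_zero, List.cons_append, List.nil_append,
      List.zip_cons_cons, List.zip_nil_left, List.mem_cons, List.not_mem_nil, or_false,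
      forall_eq_or_imp, forall_eq] at h
    obtain ⟨⟨h1, -⟩, ⟨h2, -⟩, ⟨h3, -⟩, ⟨h4, -⟩⟩ := h
    replace h1 := h1 t ht
    replace h2 := h2 t ht
    replace h3 := h3 t ht
    replace h4 := h4 t ht
    simp only [mem_supportLine_dart_zero h0, mem_supportLine_dart_one h5,
      mem_supportLine_dart_two h5, mem_supportLine_dart_three] at h1 h2 h3 h4
    simp only [chainAt, dartWavefront, List.map_cons, List.map_nil, List.cons.injEq, Prod.mk.injEq,
      true_and, and_true]
    refine ⟨?_, ?_, ?_, ?_⟩ <;> apply plane_ext <;> simp <;> linarith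

theorem map_fst_of_chainAt {n : ℕ} {m : MovingChain n} {c : Chain n} {t : ℝ}
    (h : chainAt t m = c) : m.map Prod.fst = c.map Prod.fst := by
  subst h
  simp [chainAt, Function.comp_def]

/-- Here `v` is the speed of edge 3 during the phase: 0 before time 1 and 1 after it. All vertex
velocities are affine in `v`. -/
theorem isMoving_dartWavefront {a b : ℝ} (h0 : 0 ≤ a) (h5 : b ≤ 5) (v : ℝ)
    (hv : ∀ t ∈ Icc a b, max 0 (t - 1) = max 0 (a - 1) + (t - a) * v) :
    IsMoving dart dartDelay a b dartWavefront := by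
  refine ⟨?_, fun t ht => isSimpleChain_dartWavefront (by linarith [ht.1]) (by linarith [ht.2])⟩
  obtain ⟨r, hr, hr1⟩ := exists_inwardNormal_dart_one
  obtain ⟨s, hs, hs2⟩ := exists_inwardNormal_dart_two
  simp only [dartWavefront, List.rotate_cons_succ, List.rotate_zero, List.cons_append,
    List.nil_append, List.zip_cons_cons, List.zip_nil_left, List.mem_cons, List.not_mem_nil,
    or_false, forall_eq_or_imp, forall_eq, inwardNormal_dart_zero, inwardNormal_dart_three, hr1,
    hs2]
  refine ⟨⟨fun t ht => ?_, !₂[-1, 1], ?_, fun t ht => ?_⟩, ⟨fun t ht => ?_, 0, ?_, fun t ht => ?_⟩,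
    ⟨fun t ht => ?_, !₂[v, 2 * v], ?_, fun t ht => ?_⟩,
    ⟨fun t ht => ?_, !₂[(4 - 5 * v) / 3, 1], ?_, fun t ht => ?_⟩⟩
  all_goals first
    | rw [Submodule.mem_span_pair]
    | (have ht0 : 0 ≤ t := h0.trans ht.1
       have ht5 : t ≤ 5 := ht.2.trans h5
       simp only [mem_supportLine_dart_zero ht0, mem_supportLine_dart_one ht5,
         mem_supportLine_dart_two ht5, mem_supportLine_dart_three]
       constructor <;> simp <;> ring)
    | (have := hv t ht
       apply plane_ext <;> simp <;> linarith)
  · refine ⟨2, 1 / r, ?_⟩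
    apply plane_ext <;> simp <;> field_simp
    norm_num
  · exact ⟨0, 0, by simp⟩
  · refine ⟨2 * v / s, 5 * v, ?_⟩
    apply plane_ext <;> simp <;> field_simp <;> ring
  · refine ⟨-5 * (4 - 5 * v) / 9, 1 + 4 * (4 - 5 * v) / 9, ?_⟩
    apply plane_ext <;> simp <;> ring

theorem resolves_dartWavefront_collapse : Resolves [chainAt 5 dartWavefront] [] := by
  have h : chainAt 5 dartWavefront =
      [(0, !₂[0, 5]), (1, !₂[0, 5]), (2, !₂[0, 5]), (3, !₂[0, 5])] := by
    simp only [chainAt, dartWavefront, List.map_cons, List.map_nil, List.cons.injEq,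
      Prod.mk.injEq, true_and, and_true]
    rw [max_eq_right (by norm_num)]
    refine ⟨?_, ?_, ?_⟩ <;> apply plane_ext <;> simp <;> norm_num
  rw [h]
  -- All vertices coincide: two one-edge chains are cut off and removed, and a two-edge chain
  -- remains to be removed.
  refine .cutAtVertex (X := []) (List.IsRotated.refl _) (.remove (by simp) ?_)
  refine .cutAtVertex (X := []) (List.IsRotated.refl _) (.remove (by simp) ?_)
  exact .remove (by simp) .nil

/-- The wavefront propagation of `dart`, with a speed change at time `1`. -/
noncomputable def dartPropagation : Propagation dart dartDelay where
  steps := 2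
  time := fun k => if k = 0 then 0 else if k = 1 then 1 else 5
  phase := fun k => if k < 2 then [dartWavefront] else []
  time_zero := by simp
  time_lt := by
    intro k hk
    interval_cases k <;> norm_num
  start := by simp [chainAt_zero_dartWavefront]
  moving := by
    intro k hk m hm
    have hm : m = dartWavefront := by simpa [hk] using hm
    subst hm
    interval_cases k
    · refine isMoving_dartWavefront (by simp) (by norm_num) 0 fun t ht => ?_
      simp at ht ⊢
      linarith
    · refine isMoving_dartWavefront (by simp) (by norm_num) 1 fun t ht => ?_
      simp at ht ⊢
      linarith
  resolves := by
    intro k hk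
    interval_cases k
    · simpa using .keep (isSimpleChain_dartWavefront zero_le_one (by norm_num)) .nil
    · simpa using resolves_dartWavefront_collapse
  collapsed := by simp

/-! ### Uniqueness before the collapse, and failure of monotonicity -/

namespace Propagation

variable (W : Propagation dart dartDelay)

/-- Before its collapse, the wavefront of `dart` is the same in every propagation. -/
theorem map_chainAt_phase_dart {k : ℕ} (hk : k ≤ W.steps) (h5 : W.time k < 5) :
    (W.phase k).map (chainAt (W.time k)) = [chainAt (W.time k) dartWavefront] := by
  induction k with
  | zero => rw [W.time_zero, W.start, chainAt_zero_dartWavefront]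
  | succ k ih =>
    have hlt := W.time_lt k hk
    have hr := W.resolves k hk
    have hmov := W.moving k hk
    obtain ⟨m, hm, hc⟩ := List.map_eq_singleton_iff.1 (ih (by lia) (hlt.trans h5))
    have h0 := W.time_nonneg hk
    rw [hm, List.map_singleton, (hmov m (by simp [hm])).chainAt_eq_dartWavefront
      (map_fst_of_chainAt hc) ⟨hlt.le, le_rfl⟩ h0 h5.le] at hr
    exact hr.eq_of_isSimpleChain (isSimpleChain_dartWavefront h0 h5)

theorem exists_phase_eq_dart {k : ℕ} (hk : k < W.steps) {t : ℝ}
    (ht : t ∈ Icc (W.time k) (W.time (k + 1))) (h5 : t < 5) :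
    ∃ m, W.phase k = [m] ∧ chainAt t m = chainAt t dartWavefront := by
  obtain ⟨m, hm, hc⟩ :=
    List.map_eq_singleton_iff.1 (W.map_chainAt_phase_dart hk.le (ht.1.trans_lt h5))
  exact ⟨m, hm, (W.moving k hk m (by simp [hm])).chainAt_eq_dartWavefront
    (map_fst_of_chainAt hc) ht ((W.time_nonneg hk.le).trans ht.1) h5.le⟩

/-- A propagation cannot end before time 5: its last phase is empty, whereas the wavefront is still
a quadrilateral. -/
theorem exists_mem_Icc_dart {t : ℝ} (h0 : 0 ≤ t) (h5 : t < 5) :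
    ∃ k < W.steps, t ∈ Icc (W.time k) (W.time (k + 1)) := by
  by_contra! h
  have key : ∀ k ≤ W.steps, W.time k ≤ t := by
    intro k
    induction k with
    | zero => exact fun _ => W.time_zero.trans_le h0
    | succ k ih =>
      intro hk
      by_contra! hlt
      exact h k hk ⟨ih (by lia), hlt.le⟩
  have := W.map_chainAt_phase_dart le_rfl ((key _ le_rfl).trans_lt h5)
  simp [W.collapsed] at this

theorem fragments_dart_zero {t : ℝ} (h0 : 0 ≤ t) (h5 : t < 5) :
    W.fragments 0 t = segment ℝ !₂[(4 * t - 5 * max 0 (t - 1)) / 3, t] !₂[5 - t, t] := by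
  ext x
  constructor
  · rintro ⟨k, hk, ht, m, hm, g, hg, he, hx⟩
    obtain ⟨m', hm', hc⟩ := W.exists_phase_eq_dart hk ht h5
    obtain rfl : m = m' := by simpa [hm'] using hm
    rw [hc] at hg
    simp [chainEdges, chainAt, dartWavefront] at hg
    rcases hg with rfl | rfl | rfl | rfl
    · exact hx
    all_goals simp at he
  · intro hx
    obtain ⟨k, hk, ht⟩ := W.exists_mem_Icc_dart h0 h5
    obtain ⟨m, hm, hc⟩ := W.exists_phase_eq_dart hk ht h5
    refine ⟨k, hk, ht, m, by simp [hm], (0, _, _), ?_, rfl, hx⟩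
    rw [hc]
    simp [chainEdges, chainAt, dartWavefront]

/-- Edge 0 has weight 0 and rises at unit speed, so the height of a point of its face is the time at
which it was swept. -/
theorem apply_one_of_mem_fragments_dart {t : ℝ} {x : Plane} (hx : x ∈ W.fragments 0 t) :
    x 1 = t := by
  obtain ⟨k, hk, ht, m, hm, g, hg, he, hx⟩ := hx
  have h0 := (W.time_nonneg hk.le).trans ht.1
  have h := (W.moving k hk m hm).mem_supportLine ht hg
  rw [he, mem_supportLine_dart_zero h0, mem_supportLine_dart_zero h0] at h
  obtain ⟨a, b, -, -, hab, rfl⟩ := hx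
  simp [h.1, h.2, ← add_mul, hab]

theorem not_isMonotoneWrt_face_dart : ¬ IsMonotoneWrt (W.face 0) (edgeVector dart 0) := by
  intro h
  have hperp (y : Plane) :
      inner ℝ (y - !₂[1, 0]) (edgeVector dart 0) = 0 ↔ y 0 = 1 := by
    simp [edgeVector, PiLp.inner_apply, Fin.sum_univ_two, sub_eq_zero]
  -- The heights of the face on the line x = 1 would form an interval containing 0 and 2, hence also
  -- 1.
  have hS := (h !₂[1, 0]).image (fun y : Plane => y 1) (by fun_prop)
  have h1 : (1 : ℝ) ∈ Icc (0 : ℝ) 2 := by norm_num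
  have hm0 : !₂[1, 0] ∈ W.face 0 := by
    refine mem_iUnion₂.2 ⟨0, le_rfl, ?_⟩
    rw [W.fragments_dart_zero le_rfl (by norm_num)]
    refine ⟨4 / 5, 1 / 5, by norm_num, by norm_num, by norm_num, ?_⟩
    apply plane_ext <;> simp
  have hm2 : !₂[1, 2] ∈ W.face 0 := by
    refine mem_iUnion₂.2 ⟨2, zero_le_two, ?_⟩
    rw [W.fragments_dart_zero zero_le_two (by norm_num)]
    refine ⟨1, 0, by norm_num, by norm_num, by norm_num, ?_⟩
    apply plane_ext <;> simp
    norm_num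
  obtain ⟨y, ⟨hy, hy0⟩, hy1⟩ := hS.Icc_subset ⟨_, ⟨hm0, (hperp _).2 (by simp)⟩, by simp⟩
    ⟨_, ⟨hm2, (hperp _).2 (by simp)⟩, by simp⟩ h1
  obtain ⟨t, ht, hy⟩ := mem_iUnion₂.1 hy
  obtain rfl : t = 1 := (W.apply_one_of_mem_fragments_dart hy).symm.trans hy1
  rw [W.fragments_dart_zero ht (by norm_num)] at hy
  replace hy0 := (hperp _).1 hy0
  obtain ⟨a, b, ha, hb, hab, rfl⟩ := hy
  -- At time 1 the fragment runs from x = 4/3 to x = 4 and misses x = 1.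
  simp at hy0
  linarith

end Propagation

end StraightSkeleton

/-- Some face of the additively-weighted straight skeleton of some simple polygon is not monotone
with respect to the edge that emanated it. The propagation process of the witness exists, and the
claim holds for the face as given by any such process. -/
theorem mainTheorem7 :
    ∃ (n : ℕ) (P : Polygon StraightSkeleton.Plane n) (δ : Fin n → ℝ) (e : Fin n),
      StraightSkeleton.IsSimplePolygon P ∧
      (∀ i, 0 ≤ δ i) ∧
      Nonempty (StraightSkeleton.Propagation P δ) ∧
      ∀ W : StraightSkeleton.Propagation P δ,
        ¬ StraightSkeleton.IsMonotoneWrt (W.face e) (StraightSkeleton.edgeVector P e) := by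
  refine ⟨4, StraightSkeleton.dart, StraightSkeleton.dartDelay, 0,
    StraightSkeleton.isSimplePolygon_dart, fun i => ?_, ⟨StraightSkeleton.dartPropagation⟩,
    StraightSkeleton.Propagation.not_isMonotoneWrt_face_dart⟩
  fin_cases i <;> simp [StraightSkeleton.dartDelay]
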